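/- **Theorem 5.4 (weak John–Nirenberg inequality).** Let $(\Omega,\mathcal F,P)$ be a probability space and $(\mathcal F_n)_{n\ge 0}$ a non-decreasing sequence of sub-$\sigma$-algebras of $\mathcal F$ with $\mathcal F=\sigma(\bigcup_n\mathcal F_n)$. Assume that the stochastic basis is regular: there is a constant $R>0$ such that for all $n\ge 1$ and $A\in\mathcal F_n$ there is $B\in\mathcal F_{n-1}$ with $A\subset B$ up to a $P$-null set and $P(B)\le R\,P(A)$. Let $\ell\in(0,1]$ and let $\Phi:[0,\infty)\to[0,\infty)$ be a concave function with $\Phi(0)=0$, $\Phi(r)\to\infty$ as $r\to\infty$, such that for some constant $c_\Phi\ge 1$ $$\Phi(tr)\le c_\Phi\max\{t^\ell,t\}\,\Phi(r)\qquad\text{for all } t,r\in[0,\infty)$$ (so that $\Phi$ is a bijection of $[0,\infty)$ with convex inverse $\Phi^{-1}$). Assume that $$q_{\Phi^{-1}}=\sup_{t>0}\frac{t\,(\Phi^{-1})'(t)}{\Phi^{-1}(t)}<\infty ,$$ where $(\Phi^{-1})'$ denotes the right derivative, and let $\phi(r)=\dfrac{1}{r\,\Phi^{-1}(1/r)}$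 for $r\in(0,\infty)$. For a real-valued $f\in L_1$ write $f_n=E[f\mid\mathcal F_n]$. For a stopping time $\nu:\Omega\to\{0,1,2,\dots\}\cup\{\infty\}$ let $f^\nu$ be (the terminal value of) the stopped martingale, that is, $f^\nu=f_\nu$ on $\{\nu<\infty\}$ and $f^\nu=f$ on $\{\nu=\infty\}$. For $q\in[1,\infty)$ put $$\|f\|_{w\mathcal L_{q,\phi}}=\int_0^\infty\frac{t^q_\phi(x)}{x}\,dx\in[0,\infty],\qquad t_\phi^q(x)=\frac{1}{\phi(x)}\,x^{-1/q}\sup_{P(\nu<\infty)\le x}\|f-f^\nu\|_q ,$$ the supremum being over stopping times $\nu$, and let $$w\mathcal L_{q,\phi}=\{f\in L_q:\ E[f\mid\mathcal F_0]=0,\ \|f\|_{w\mathcal L_{q,\phi}}<\infty\}.$$ Then the spaces $w\mathcal L_{q,\phi}$, $1\le q<\infty$, coincide, with equivalent norms: for all $q_1,q_2\in[1,\infty)$ one has $w\mathcal L_{q_1,\phi}=w\mathcal L_{q_2,\phi}$, and there is a constant $C>0$ such that for every $f\in L_1$ $$\|f\|_{w\mathcal L_{q_1,\phi}}\le C\,\|f\|_{w\mathcal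 L_{q_2,\phi}}\quad\text{and}\quad \|f\|_{w\mathcal L_{q_2,\phi}}\le C\,\|f\|_{w\mathcal L_{q_1,\phi}} .$$ If, in addition, the regularity condition holds at $n=0$ with respect to the trivial $\sigma$-algebra, i.e. there is $R_0>0$ with $R_0\,P(A)\ge 1$ for every $A\in\mathcal F_0$ with $P(A)>0$ (for instance, if $\mathcal F_0$ is trivial), then the spaces $\{f\in L_q:\|f\|_{w\mathcal L_{q,\phi}}<\infty\}$, without the normalization $E[f\mid\mathcal F_0]=0$, coincide as well for all $1\le q<\infty$. -/

import Mathlib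

open MeasureTheory ProbabilityTheory Filter Set
open scoped ENNReal NNReal Topology

noncomputable section

/-- The class `G_ℓ`: functions `Φ : [0,∞) → [0,∞)` with `Φ 0 = 0`, `Φ r → ∞` as `r → ∞`, of lower
type `ℓ` and upper type `1`. (Only the values of `Φ` on `[0,∞)` matter.) -/
structure OrliczClass (ℓ : ℝ) (Φ : ℝ → ℝ) : Prop where
  nonneg : ∀ r, 0 ≤ r → 0 ≤ Φ r
  map_zero : Φ 0 = 0
  tendsto_atTop : Tendsto Φ atTop atTop
  type_le : ∃ c : ℝ, 1 ≤ c ∧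
    ∀ t r : ℝ, 0 ≤ t → 0 ≤ r → Φ (t * r) ≤ c * max (t ^ ℓ) t * Φ r

/-- The inverse function of a bijection `Φ` of `[0,∞)` onto itself. -/
def orliczInv (Φ : ℝ → ℝ) : ℝ → ℝ := Function.invFunOn Φ (Ici 0)

/-- The upper index `sup_{t > 0} t Ψ'(t) / Ψ(t)`, where `Ψ'` is the right derivative. (It is used for
convex `Ψ`, whose right derivative exists at every `t > 0`.) -/
def upperIndex (Ψ : ℝ → ℝ) : ℝ≥0∞ :=
  ⨆ (t : ℝ) (_ : 0 < t), ENNReal.ofReal (t * derivWithin Ψ (Ioi t) t / Ψ t)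

section Basis

variable {Ω : Type*} {mΩ : MeasurableSpace Ω}

/-- Regularity of a stochastic basis: a set of `ℱ (n+1)` is covered, up to a null set, by a set
of `ℱ n` of comparable probability, with a constant independent of `n`. -/
def IsRegularBasis (P : Measure Ω) (ℱ : Filtration ℕ mΩ) : Prop :=
  ∃ R : ℝ≥0, 0 < R ∧ ∀ (n : ℕ) (A : Set Ω), MeasurableSet[ℱ (n + 1)] A →
    ∃ B : Set Ω, MeasurableSet[ℱ n] B ∧ A ≤ᵐ[P] B ∧ P B ≤ R * P A

/-- The regularity condition at the first step, `ℱ 0` being compared with the trivial `σ`-algebra: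
every set of `ℱ 0` which is not null is covered by the whole space, of comparable probability. -/
def IsRegularAtZero (P : Measure Ω) (ℱ : Filtration ℕ mΩ) : Prop :=
  ∃ R : ℝ≥0, 0 < R ∧ ∀ A : Set Ω, MeasurableSet[ℱ 0] A → P A ≠ 0 → P univ ≤ R * P A

/-- The (terminal value of the) stopped martingale `f^ν` of the martingale `f_n = E[f | ℱ n]`:
it is `f_ν` on `{ν < ∞}` and `f` on `{ν = ∞}`. -/
def stoppedFun (P : Measure Ω) (ℱ : Filtration ℕ mΩ) (f : Ω → ℝ) (ν : Ω → WithTop ℕ) : Ω → ℝ :=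
  fun ω => if ν ω = ⊤ then f ω else stoppedValue (fun n => P[f | ℱ n]) ν ω

/-- `sup ‖f - f^ν‖_q` over all stopping times `ν` with `P(ν < ∞) ≤ x`. -/
def stoppedOsc (P : Measure Ω) (ℱ : Filtration ℕ mΩ) (q : ℝ) (f : Ω → ℝ) (x : ℝ) : ℝ≥0∞ :=
  ⨆ (ν : Ω → WithTop ℕ) (_ : IsStoppingTime ℱ ν) (_ : P {ω | ν ω < ⊤} ≤ ENNReal.ofReal x),
    eLpNorm (fun ω => f ω - stoppedFun P ℱ f ν ω) (ENNReal.ofReal q) P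

/-- `t_φ^q(x) = φ(x)⁻¹ x^{-1/q} sup_{P(ν < ∞) ≤ x} ‖f - f^ν‖_q`. -/
def tPhi (P : Measure Ω) (ℱ : Filtration ℕ mΩ) (q : ℝ) (φ : ℝ → ℝ) (f : Ω → ℝ) (x : ℝ) : ℝ≥0∞ :=
  ENNReal.ofReal (1 / φ x * x ^ (-1 / q)) * stoppedOsc P ℱ q f x

/-- The weak Campanato norm `∫_0^∞ t_φ^q(x) / x dx`. -/
def wCampanatoNorm (P : Measure Ω) (ℱ : Filtration ℕ mΩ) (q : ℝ) (φ : ℝ → ℝ) (f : Ω → ℝ) : ℝ≥0∞ :=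
  ∫⁻ x in Ioi (0 : ℝ), tPhi P ℱ q φ f x / ENNReal.ofReal x

/-- The functions of `L_q` with finite weak Campanato norm, without normalization at time `0`. -/
def wCampanato (P : Measure Ω) (ℱ : Filtration ℕ mΩ) (q : ℝ) (φ : ℝ → ℝ) : Set (Ω → ℝ) :=
  {f | MemLp f (ENNReal.ofReal q) P ∧ wCampanatoNorm P ℱ q φ f < ∞}

/-- The weak Campanato space with the convention `E_0 f = 0`. -/
def wCampanatoZero (P : Measure Ω) (ℱ : Filtration ℕ mΩ) (q : ℝ) (φ : ℝ → ℝ) : Set (Ω → ℝ) :=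
  {f | f ∈ wCampanato P ℱ q φ ∧ P[f | ℱ 0] =ᵐ[P] 0}

end Basis

end

/-!
The theorem follows from a Calderón–Zygmund iteration with stopping times. Write
`O_q(x) = sup ‖f - f^ν‖_q` over the stopping times with `P(ν < ∞) ≤ x`, and `Ψ = Φ⁻¹`. The norm is
then `∫ Ψ(1/x) x^{-1/q} O_q(x) dx`, and it suffices to compare every `q` with `q = 1`.

Hölder's inequality on `{ν < ∞}` gives `x⁻¹ O_1(x) ≤ x^{-1/q} O_q(x)`
(`stoppedOsc_one_le`), hence one of the two inequalities.

For the converse, fix `ν` with `P(ν < ∞) ≤ x` and continue the martingale from `ν` until its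
increment is about to exceed `2 R O_1(x) / x`. By Doob's maximal inequality
(`exists_exceedance_sets`) the increment exceeds this level with probability at most `x / (2 R)`;
by regularity one can stop one step earlier, so that the jump does not enter, and the
probability of stopping is still at most `x / 2` (`exists_isStoppingTime_before`,
`exists_next_isStoppingTime`). Iterating along the scales `x / 2 ^ j` bounds `|f - f^ν|` by a sum of
multiples of indicators of small sets, which gives
`O_q(x) ≤ 2 R ∑ j, O_1(x / 2 ^ j) (x / 2 ^ j)^{1 / q - 1}` (`stoppedOsc_le_tsum`). When this is
integrated against `Ψ(1/x) x^{-1/q}`, the `j`-th term is the dilation by `2 ^ j` of the integrand of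
the norm for `q = 1`, times `2^{-j/q}`: convexity of `Ψ` gives `Ψ(1/x) ≤ 2^{-j} Ψ(2 ^ j / x)`, which
compensates the Jacobian `2 ^ j`. The geometric series converges (`exists_wCampanatoNorm_le`).

For the equality of the spaces it remains to see that a finite norm implies `f ∈ L_q`. The stopping
time `ν = 0` shows `f - E[f | ℱ 0] ∈ L_q` (`memLp_of_wCampanatoNorm_lt_top`), and `E[f | ℱ 0]` is zero
by the normalization or essentially bounded by regularity at time `0`
(`memLp_top_of_isRegularAtZero`).
-/

/-! ### Stopping before a jump -/

section Martingale

variable {Ω : Type*} {mΩ : MeasurableSpace Ω} {P : Measure Ω} {ℱ : Filtration ℕ mΩ}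

/-- On a regular basis one can stop one step before the events `A n ∈ ℱ (n + 1)` occur, at the
price of a factor `R` in the probability of stopping at all. The sets `G n` restrict where stopping
is allowed; taking `G n = {ν ≤ n}` keeps the new stopping time after `ν`. -/
theorem exists_isStoppingTime_before {R : ℝ≥0}
    (hR : ∀ (n : ℕ) (A : Set Ω), MeasurableSet[ℱ (n + 1)] A →
      ∃ B : Set Ω, MeasurableSet[ℱ n] B ∧ A ≤ᵐ[P] B ∧ P B ≤ R * P A)
    {A G : ℕ → Set Ω} (hA : ∀ n, MeasurableSet[ℱ (n + 1)] (A n))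
    (hG : ∀ n, MeasurableSet[ℱ n] (G n)) (hAG : ∀ n, A n ⊆ G n) :
    ∃ τ : Ω → WithTop ℕ, IsStoppingTime ℱ τ ∧ (∀ ω (n : ℕ), τ ω = n → ω ∈ G n) ∧
      (∀ᵐ ω ∂P, ∀ n, ω ∈ A n → τ ω ≤ n) ∧ P {ω | τ ω < ⊤} ≤ R * ∑' n, P (A n) := by
  classical
  choose B hB hAB hPB using fun n => hR n (A n) (hA n)
  let D : ℕ → Set Ω := fun n => B n ∩ G n
  let τ : Ω → WithTop ℕ := fun ω =>
    if h : ∃ n, ω ∈ D n then ((Nat.find h : ℕ) : WithTop ℕ) else ⊤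
  have hle : ∀ ω (n : ℕ), τ ω ≤ n ↔ ∃ k ≤ n, ω ∈ D k := by
    intro ω n
    by_cases h : ∃ n, ω ∈ D n
    · simp only [τ, dif_pos h, Nat.cast_withTop, WithTop.coe_le_coe, Nat.find_le_iff]
    · simp only [τ, dif_neg h, Nat.cast_withTop, top_le_iff, WithTop.coe_ne_top, false_iff]
      exact fun ⟨k, _, hk⟩ => h ⟨k, hk⟩
  refine ⟨τ, fun n => ?_, fun ω n hn => ?_, ?_, ?_⟩
  · have : {ω | τ ω ≤ n} = ⋃ k ∈ Iic n, D k := by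
      ext ω
      simpa using hle ω n
    change MeasurableSet[ℱ n] {ω | τ ω ≤ (n : WithTop ℕ)}
    rw [this]
    exact MeasurableSet.biUnion (to_countable _)
      fun k hk => ℱ.mono hk _ ((hB k).inter (hG k))
  · by_cases h : ∃ n, ω ∈ D n
    · simp only [τ, dif_pos h, Nat.cast_withTop, WithTop.coe_inj] at hn
      exact hn ▸ (Nat.find_spec h).2
    · simp [τ, dif_neg h] at hn
  · filter_upwards [ae_all_iff.2 hAB] with ω hω n hn
    exact (hle ω n).2 ⟨n, le_rfl, hω n hn, hAG n hn⟩
  · have : {ω | τ ω < ⊤} ⊆ ⋃ n, B n := by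
      intro ω hω
      by_cases h : ∃ n, ω ∈ D n
      · obtain ⟨n, hn⟩ := h
        exact mem_iUnion.2 ⟨n, hn.1⟩
      · simp [τ, dif_neg h] at hω
    calc P {ω | τ ω < ⊤} ≤ ∑' n, P (B n) := (measure_mono this).trans (measure_iUnion_le B)
      _ ≤ ∑' n, R * P (A n) := ENNReal.tsum_le_tsum hPB
      _ = R * ∑' n, P (A n) := ENNReal.tsum_mul_left

theorem stoppedFun_of_eq_top {f : Ω → ℝ} {ν : Ω → WithTop ℕ} {ω : Ω} (h : ν ω = ⊤) :
    stoppedFun P ℱ f ν ω = f ω := by simp [stoppedFun, h]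

theorem stoppedFun_of_eq_coe {f : Ω → ℝ} {ν : Ω → WithTop ℕ} {ω : Ω} {n : ℕ} (h : ν ω = n) :
    stoppedFun P ℱ f ν ω = P[f | ℱ n] ω := by
  simp only [stoppedFun, h, stoppedValue, Nat.cast_withTop, WithTop.coe_ne_top, if_false]
  rfl

theorem measurableSet_stoppingTime_eq {ν : Ω → WithTop ℕ} (hν : IsStoppingTime ℱ ν)
    (i : WithTop ℕ) : MeasurableSet {ω | ν ω = i} := by
  have h (n : ℕ) : MeasurableSet {ω | ν ω ≤ n} := ℱ.le n _ (hν n)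
  induction i with
  | top =>
    have : {ω | ν ω = ⊤} = ⋂ n : ℕ, {ω | ν ω ≤ n}ᶜ := by
      ext ω
      simp only [mem_ofPred_eq, mem_iInter, mem_compl_iff, not_le]
      refine ⟨fun h n => h ▸ WithTop.coe_lt_top n, fun h => ?_⟩
      by_contra h'
      obtain ⟨m, hm⟩ := WithTop.ne_top_iff_exists.1 h'
      exact lt_irrefl _ (hm ▸ h m)
    rw [this]
    exact MeasurableSet.iInter fun n => (h n).compl
  | coe n => exact ℱ.le n _ (hν.measurableSet_eq n)

theorem aestronglyMeasurable_stoppedFun {f : Ω → ℝ} (hf : AEStronglyMeasurable f P)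
    {ν : Ω → WithTop ℕ} (hν : IsStoppingTime ℱ ν) :
    AEStronglyMeasurable (stoppedFun P ℱ f ν) P := by
  have hU : (⋃ i : WithTop ℕ, {ω | ν ω = i}) = univ := by ext; simp
  suffices AEStronglyMeasurable (stoppedFun P ℱ f ν) (P.restrict (⋃ i, {ω | ν ω = i})) by
    rwa [hU, Measure.restrict_univ] at this
  rw [aestronglyMeasurable_iUnion_iff]
  intro i
  have hm := measurableSet_stoppingTime_eq hν i
  induction i with
  | top =>
    refine hf.restrict.congr ?_
    filter_upwards [ae_restrict_mem hm] with ω hω using (stoppedFun_of_eq_top hω).symm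
  | coe n =>
    refine (stronglyMeasurable_condExp.mono (ℱ.le n)).aestronglyMeasurable.congr
      (f := P[f | ℱ n]) ?_
    filter_upwards [ae_restrict_mem hm] with ω hω using (stoppedFun_of_eq_coe hω).symm

/-- Conditioning contracts `∫_A |·|` for `A` in the conditioning `σ`-algebra; the `m`-measurable
function `h` is left unchanged by it. -/
theorem setLIntegral_enorm_condExp_sub_le [IsFiniteMeasure P] {m : MeasurableSpace Ω} (hm : m ≤ mΩ)
    {f h : Ω → ℝ} (hf : Integrable f P) (hh : Integrable h P) (hhm : StronglyMeasurable[m] h)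
    {A : Set Ω} (hA : MeasurableSet[m] A) :
    ∫⁻ ω in A, ‖P[f | m] ω - h ω‖ₑ ∂P ≤ ∫⁻ ω in A, ‖f ω - h ω‖ₑ ∂P := by
  have h1 : P[f - h | m] =ᵐ[P] fun ω => P[f | m] ω - h ω := by
    filter_upwards [condExp_sub hf hh m] with ω hω
    rw [hω, Pi.sub_apply, condExp_of_stronglyMeasurable hm hhm hh]
  have h2 := setIntegral_abs_condExp_le (μ := P) hA (f - h)
  calc ∫⁻ ω in A, ‖P[f | m] ω - h ω‖ₑ ∂P = ∫⁻ ω in A, ‖P[f - h | m] ω‖ₑ ∂P := by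
        refine lintegral_congr_ae (ae_restrict_of_ae ?_)
        filter_upwards [h1] with ω hω
        rw [hω]
    _ = ENNReal.ofReal (∫ ω in A, ‖P[f - h | m] ω‖ ∂P) :=
        (ofReal_integral_norm_eq_lintegral_enorm integrable_condExp.restrict).symm
    _ ≤ ENNReal.ofReal (∫ ω in A, ‖(f - h) ω‖ ∂P) := ENNReal.ofReal_le_ofReal h2
    _ = ∫⁻ ω in A, ‖f ω - h ω‖ₑ ∂P :=
        ofReal_integral_norm_eq_lintegral_enorm (hf.sub hh).restrict

/-- Doob's maximal inequality for the part of a martingale after the stopping time `ν`. The maximal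
function is split according to the first index at which it exceeds `lam`. -/
theorem exists_exceedance_sets [IsFiniteMeasure P] {f : Ω → ℝ} (hf : Integrable f P)
    {ν : Ω → WithTop ℕ} (hν : IsStoppingTime ℱ ν) (lam : ℝ) :
    ∃ A : ℕ → Set Ω, (∀ n, MeasurableSet[ℱ (n + 1)] (A n)) ∧ (∀ n, A n ⊆ {ω | ν ω ≤ n}) ∧
      (∀ ω (n : ℕ), ν ω ≤ n → lam < |P[f | ℱ (n + 1)] ω - stoppedFun P ℱ f ν ω| →
        ∃ k ≤ n, ω ∈ A k) ∧
      ENNReal.ofReal lam * ∑' n, P (A n) ≤ eLpNorm (fun ω => f ω - stoppedFun P ℱ f ν ω) 1 P := by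
  let u : ℕ → Ω → ℝ := fun n => P[f | ℱ n]
  let h : ℕ → Ω → ℝ := fun n => stoppedValue u fun ω => min (ν ω) n
  have hprog : IsStronglyProgressive ℱ u :=
    StronglyAdapted.isStronglyProgressive_of_discrete fun n => stronglyMeasurable_condExp
  have hhm (n : ℕ) : StronglyMeasurable[ℱ n] (h n) :=
    stronglyMeasurable_stoppedValue_of_le hprog (hν.min_const n) fun _ => min_le_right _ _
  have hhi (n : ℕ) : Integrable (h n) P :=
    integrable_stoppedValue ℕ (hν.min_const n) (fun _ => integrable_condExp)
      fun _ => min_le_right _ _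
  have hheq (n : ℕ) (ω : Ω) (hω : ν ω ≤ n) : stoppedFun P ℱ f ν ω = h n ω := by
    have : ν ω ≠ ⊤ := (lt_of_le_of_lt hω (WithTop.coe_lt_top n)).ne
    simp [stoppedFun, this, h, stoppedValue, u, min_eq_left hω]
  let E : ℕ → Set Ω := fun n => {ω | ν ω ≤ n} ∩ {ω | lam < |u (n + 1) ω - h n ω|}
  have hE (n : ℕ) : MeasurableSet[ℱ (n + 1)] (E n) := by
    refine (ℱ.mono n.le_succ _ (hν n)).inter ?_
    have h1 : Measurable[ℱ (n + 1)] fun ω => |u (n + 1) ω - h n ω| := by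
      have := (stronglyMeasurable_condExp (m := ℱ (n + 1)) (μ := P) (f := f)).sub
        ((hhm n).mono (ℱ.mono n.le_succ))
      exact (this.norm).measurable
    exact measurableSet_lt measurable_const h1
  have hA (n : ℕ) : MeasurableSet[ℱ (n + 1)] (disjointed E n) := by
    rw [disjointed_eq_inter_compl]
    exact (hE n).inter (MeasurableSet.biInter (to_countable _) fun k hk =>
      (ℱ.mono (Nat.succ_le_succ (le_of_lt hk)) _ (hE k)).compl)
  refine ⟨disjointed E, hA, fun n => (disjointed_subset E n).trans inter_subset_left,
    fun ω n hn hlam => ?_, ?_⟩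
  · have h1 : ω ∈ partialSups (disjointed E) n := by
      rw [partialSups_disjointed]
      exact le_partialSups E n ⟨hn, by rwa [hheq n ω hn] at hlam⟩
    rw [partialSups_eq_biSup] at h1
    obtain ⟨k, hk, hkω⟩ := mem_iUnion₂.1 h1
    exact ⟨k, hk, hkω⟩
  · have hA' (n : ℕ) : MeasurableSet (disjointed E n) := ℱ.le _ _ (hA n)
    calc ENNReal.ofReal lam * ∑' n, P (disjointed E n)
        = ∑' n, ENNReal.ofReal lam * P (disjointed E n) := ENNReal.tsum_mul_left.symm
      _ ≤ ∑' n, ∫⁻ ω in disjointed E n, ‖f ω - stoppedFun P ℱ f ν ω‖ₑ ∂P := by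
          refine ENNReal.tsum_le_tsum fun n => ?_
          rw [← setLIntegral_const]
          calc ∫⁻ _ in disjointed E n, ENNReal.ofReal lam ∂P
              ≤ ∫⁻ ω in disjointed E n, ‖u (n + 1) ω - h n ω‖ₑ ∂P := by
                refine setLIntegral_mono' (hA' n) fun ω hω => ?_
                rw [← ofReal_norm]
                exact ENNReal.ofReal_le_ofReal (disjointed_subset E n hω).2.le
            _ ≤ ∫⁻ ω in disjointed E n, ‖f ω - h n ω‖ₑ ∂P :=
                setLIntegral_enorm_condExp_sub_le (ℱ.le _) hf (hhi n)
                  ((hhm n).mono (ℱ.mono n.le_succ)) (hA n)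
            _ = ∫⁻ ω in disjointed E n, ‖f ω - stoppedFun P ℱ f ν ω‖ₑ ∂P := by
                refine setLIntegral_congr_fun (hA' n) fun ω hω => ?_
                simp only [hheq n ω (disjointed_subset E n hω).1]
      _ = ∫⁻ ω in ⋃ n, disjointed E n, ‖f ω - stoppedFun P ℱ f ν ω‖ₑ ∂P :=
          (lintegral_iUnion hA' (disjoint_disjointed E) _).symm
      _ ≤ ∫⁻ ω, ‖f ω - stoppedFun P ℱ f ν ω‖ₑ ∂P := setLIntegral_le_lintegral _ _
      _ = eLpNorm (fun ω => f ω - stoppedFun P ℱ f ν ω) 1 P := eLpNorm_one_eq_lintegral_enorm.symm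

/-- One Calderón–Zygmund step: from `ν` the martingale is continued until its increment is about
to exceed `2 R c`. Stopping before the jump keeps the increment bounded, and Doob's inequality
halves the probability of stopping. -/
theorem exists_next_isStoppingTime [IsFiniteMeasure P] (hgen : ⨆ n, (ℱ n : MeasurableSpace Ω) = mΩ)
    {R : ℝ≥0}
    (hR : ∀ (n : ℕ) (A : Set Ω), MeasurableSet[ℱ (n + 1)] A →
      ∃ B : Set Ω, MeasurableSet[ℱ n] B ∧ A ≤ᵐ[P] B ∧ P B ≤ R * P A)
    {f : Ω → ℝ} (hf : Integrable f P) {ν : Ω → WithTop ℕ} (hν : IsStoppingTime ℱ ν)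
    {c : ℝ≥0} {y : ℝ≥0∞}
    (hy : eLpNorm (fun ω => f ω - stoppedFun P ℱ f ν ω) 1 P ≤ c * y) :
    ∃ τ : Ω → WithTop ℕ, IsStoppingTime ℱ τ ∧ P {ω | τ ω < ⊤} ≤ y / 2 ∧
      ∀ᵐ ω ∂P, ‖stoppedFun P ℱ f τ ω - stoppedFun P ℱ f ν ω‖ ≤
        {ω | ν ω < ⊤}.indicator (fun _ => (2 * R * c : ℝ)) ω := by
  have hfm := hf.aestronglyMeasurable
  -- For `c = 0` the level is `0`, for which Doob's inequality says nothing, but then `f = f^ν`.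
  rcases eq_or_ne c 0 with rfl | hc
  · refine ⟨fun _ => ⊤, fun n => by simp, by simp, ?_⟩
    have h0 : eLpNorm (fun ω => f ω - stoppedFun P ℱ f ν ω) 1 P = 0 := by simpa using hy
    filter_upwards [(eLpNorm_eq_zero_iff (hfm.sub (aestronglyMeasurable_stoppedFun hfm hν))
      one_ne_zero).1 h0] with ω hω
    have : f ω - stoppedFun P ℱ f ν ω = 0 := hω
    rw [stoppedFun_of_eq_top (ν := fun _ => ⊤) rfl, this]
    simp
  have hRc : (0 : ℝ) ≤ 2 * R * c := by positivity
  obtain ⟨A, hA, hAν, hex, hsum⟩ := exists_exceedance_sets hf hν (2 * R * c)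
  obtain ⟨τ, hτ, hτν, hτA, hPτ⟩ := exists_isStoppingTime_before hR hA (fun n => hν n) hAν
  refine ⟨τ, hτ, ?_, ?_⟩
  · have h1 : ((2 * c : ℝ≥0) : ℝ≥0∞) * (R * ∑' n, P (A n)) ≤ c * y := by
      refine le_trans (le_of_eq ?_) (hsum.trans hy)
      have : (2 * R * c : ℝ) = ((2 * c * R : ℝ≥0) : ℝ) := by push_cast; ring
      rw [this, ENNReal.ofReal_coe_nnreal, ENNReal.coe_mul (2 * c) R, mul_assoc]
    have h2 : (c : ℝ≥0∞) * (2 * (R * ∑' n, P (A n))) ≤ c * y := by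
      rw [← mul_assoc, mul_comm (c : ℝ≥0∞) 2]
      simpa using h1
    have h3 := (ENNReal.mul_le_mul_iff_right (by simpa using hc) ENNReal.coe_ne_top).1 h2
    refine hPτ.trans ?_
    rw [ENNReal.le_div_iff_mul_le (by simp) (by simp), mul_comm]
    exact h3
  · have hlim := tendsto_ae_condExp (ℱ := ℱ) (μ := P) f
    rw [hgen] at hlim
    filter_upwards [hτA, hlim, condExp_of_aestronglyMeasurable' le_rfl hfm hf]
      with ω hω hlim hfω
    rw [hfω] at hlim
    have hντ : ν ω ≤ τ ω := by
      rcases eq_or_ne (τ ω) ⊤ with h | h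
      · simp [h]
      · obtain ⟨n, hn⟩ := WithTop.ne_top_iff_exists.1 h
        exact hn ▸ hτν ω n hn.symm
    -- Strictly before `τ`, the increment at the following time is still below the level.
    have hbd : ∀ n : ℕ, ν ω ≤ n → (n : WithTop ℕ) < τ ω →
        |P[f | ℱ (n + 1)] ω - stoppedFun P ℱ f ν ω| ≤ 2 * R * c := by
      intro n hn hnτ
      by_contra! hlt
      obtain ⟨k, hk, hkA⟩ := hex ω n hn hlt
      exact absurd ((hω k hkA).trans (WithTop.coe_le_coe.2 hk)) (not_le.2 hnτ)
    rcases eq_or_ne (ν ω) ⊤ with hνt | hνt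
    · have : τ ω = ⊤ := top_le_iff.1 (hνt ▸ hντ)
      rw [stoppedFun_of_eq_top hνt, stoppedFun_of_eq_top this, sub_self, norm_zero]
      exact indicator_nonneg (fun _ _ => hRc) _
    rw [indicator_of_mem (show ω ∈ {ω | ν ω < ⊤} from lt_top_iff_ne_top.2 hνt)]
    obtain ⟨k, hk⟩ := WithTop.ne_top_iff_exists.1 hνt
    rcases eq_or_ne (τ ω) ⊤ with hτt | hτt
    · rw [stoppedFun_of_eq_top hτt]
      have hl := ((hlim.comp (tendsto_add_atTop_nat 1)).sub_const (stoppedFun P ℱ f ν ω)).norm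
      refine le_of_tendsto hl ?_
      filter_upwards [eventually_ge_atTop k] with n hn
      exact hbd n (hk ▸ WithTop.coe_le_coe.2 hn) (hτt ▸ WithTop.coe_lt_top n)
    · obtain ⟨m, hm⟩ := WithTop.ne_top_iff_exists.1 hτt
      rw [stoppedFun_of_eq_coe hm.symm]
      have hkm : k ≤ m := by rw [← hk, ← hm] at hντ; exact WithTop.coe_le_coe.1 hντ
      rcases hkm.eq_or_lt with rfl | hlt
      · rw [stoppedFun_of_eq_coe hk.symm, sub_self, norm_zero]
        exact hRc
      · obtain ⟨n, rfl⟩ : ∃ n, m = n + 1 := ⟨m - 1, by omega⟩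
        have hkn : k ≤ n := by omega
        refine hbd n ?_ ?_
        · rw [← hk]
          exact WithTop.coe_le_coe.2 hkn
        · rw [← hm]
          exact WithTop.coe_lt_coe.2 n.lt_succ_self

end Martingale

/-! ### The oscillation at a fixed scale -/

section Oscillation

variable {Ω : Type*} {mΩ : MeasurableSpace Ω} {P : Measure Ω} {ℱ : Filtration ℕ mΩ}

theorem stoppedOsc_mono (q : ℝ) (f : Ω → ℝ) : Monotone (stoppedOsc P ℱ q f) := fun _ _ hxy =>
  iSup_mono fun _ => iSup_mono fun _ =>
    iSup_const_mono fun h => h.trans (ENNReal.ofReal_le_ofReal hxy)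

theorem eLpNorm_sub_stoppedFun_le_stoppedOsc {q x : ℝ} {f : Ω → ℝ} {ν : Ω → WithTop ℕ}
    (hν : IsStoppingTime ℱ ν) (hx : P {ω | ν ω < ⊤} ≤ ENNReal.ofReal x) :
    eLpNorm (fun ω => f ω - stoppedFun P ℱ f ν ω) (ENNReal.ofReal q) P ≤ stoppedOsc P ℱ q f x :=
  le_iSup_of_le ν (le_iSup_of_le hν (le_iSup_of_le hx le_rfl))

/-- Hölder's inequality, `f - f^ν` being supported in `{ν < ∞}`. -/
theorem stoppedOsc_one_le {q x : ℝ} (hq : 1 ≤ q) {f : Ω → ℝ}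
    (hf : AEStronglyMeasurable f P) :
    stoppedOsc P ℱ 1 f x ≤ stoppedOsc P ℱ q f x * ENNReal.ofReal x ^ (1 - 1 / q) := by
  refine iSup_le fun ν => iSup_le fun hν => iSup_le fun hx => ?_
  have hsupp : Function.support (fun ω => f ω - stoppedFun P ℱ f ν ω) ⊆ {ω | ν ω < ⊤} := by
    intro ω hω
    refine (lt_top_iff_ne_top (a := ν ω)).2 fun h => hω ?_
    simp [stoppedFun_of_eq_top h]
  have hg := hf.sub (aestronglyMeasurable_stoppedFun hf hν)
  have h1 := eLpNorm_le_eLpNorm_mul_rpow_measure_univ (μ := P.restrict {ω | ν ω < ⊤})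
    (ENNReal.ofReal_le_ofReal hq) hg.restrict
  have hq0 : 0 ≤ 1 - 1 / q := by
    rw [sub_nonneg, div_le_one (by linarith)]
    exact hq
  change eLpNorm (fun ω => f ω - stoppedFun P ℱ f ν ω) _ _ ≤
    eLpNorm (fun ω => f ω - stoppedFun P ℱ f ν ω) _ _ * _ at h1
  rw [eLpNorm_restrict_eq_of_support_subset hsupp, eLpNorm_restrict_eq_of_support_subset hsupp,
    Measure.restrict_apply_univ, ENNReal.toReal_ofReal zero_le_one,
    ENNReal.toReal_ofReal (by linarith), div_one] at h1
  exact h1.trans (mul_le_mul' (eLpNorm_sub_stoppedFun_le_stoppedOsc hν hx)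
    (ENNReal.rpow_le_rpow hx hq0))

/-- A telescoping bound along stopping times that are almost surely `∞` from some index on,
by Minkowski's inequality and Fatou's lemma. -/
theorem eLpNorm_sub_stoppedFun_le_tsum {f : Ω → ℝ} (hf : AEStronglyMeasurable f P) {p : ℝ≥0∞}
    (hp : 1 ≤ p) {τ : ℕ → Ω → WithTop ℕ} (hτ : ∀ j, IsStoppingTime ℱ (τ j))
    (hsum : ∑' j, P {ω | τ j ω < ⊤} ≠ ∞) :
    eLpNorm (fun ω => f ω - stoppedFun P ℱ f (τ 0) ω) p P ≤
      ∑' j, eLpNorm (fun ω => stoppedFun P ℱ f (τ (j + 1)) ω - stoppedFun P ℱ f (τ j) ω) p P := by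
  have hm (j : ℕ) := aestronglyMeasurable_stoppedFun hf (hτ j)
  have hlim : ∀ᵐ ω ∂P, Tendsto (fun J => stoppedFun P ℱ f (τ J) ω - stoppedFun P ℱ f (τ 0) ω)
      atTop (𝓝 (f ω - stoppedFun P ℱ f (τ 0) ω)) := by
    filter_upwards [ae_eventually_notMem hsum] with ω hω
    refine (tendsto_const_nhds (x := f ω)).congr' ?_ |>.sub_const _
    filter_upwards [hω] with J hJ
    exact (stoppedFun_of_eq_top (not_lt_top_iff.1 hJ)).symm
  refine (Lp.eLpNorm_lim_le_liminf_eLpNorm (fun J => (hm J).sub (hm 0)) _ hlim).trans ?_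
  refine liminf_le_of_le (by isBoundedDefault) fun b hb => ?_
  obtain ⟨J, hJ⟩ := hb.exists
  refine hJ.trans (le_trans ?_ (ENNReal.sum_le_tsum (Finset.range J)))
  refine le_trans (le_of_eq ?_) (eLpNorm_sum_le (fun j _ => (hm (j + 1)).sub (hm j)) hp)
  congr 1
  exact (Finset.sum_range_sub (fun j => stoppedFun P ℱ f (τ j)) J).symm

/-- The weak John–Nirenberg inequality at scale `x`: the Calderón–Zygmund step is iterated along
the scales `x / 2 ^ j`. -/
theorem stoppedOsc_le_tsum [IsFiniteMeasure P] (hgen : ⨆ n, (ℱ n : MeasurableSpace Ω) = mΩ)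
    {R : ℝ≥0} (hR0 : 0 < R)
    (hR : ∀ (n : ℕ) (A : Set Ω), MeasurableSet[ℱ (n + 1)] A →
      ∃ B : Set Ω, MeasurableSet[ℱ n] B ∧ A ≤ᵐ[P] B ∧ P B ≤ R * P A)
    {f : Ω → ℝ} (hf : Integrable f P) {q x : ℝ} (hq : 1 ≤ q) (hx : 0 < x) :
    stoppedOsc P ℱ q f x ≤ 2 * R * ∑' j : ℕ, stoppedOsc P ℱ 1 f (x / 2 ^ j) /
      ENNReal.ofReal (x / 2 ^ j) * ENNReal.ofReal (x / 2 ^ j) ^ (1 / q) := by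
  have hxj (j : ℕ) : 0 < x / 2 ^ j := by positivity
  have hxe (j : ℕ) : ENNReal.ofReal (x / 2 ^ j) ≠ 0 := (ENNReal.ofReal_pos.2 (hxj j)).ne'
  -- If the oscillation at scale `x` is infinite, so is the term `j = 0`.
  rcases eq_or_ne (stoppedOsc P ℱ 1 f x) ⊤ with htop | htop
  · have h0 : stoppedOsc P ℱ 1 f (x / 2 ^ 0) / ENNReal.ofReal (x / 2 ^ 0) *
        ENNReal.ofReal (x / 2 ^ 0) ^ (1 / q) = ⊤ := by
      rw [pow_zero, div_one, htop, ENNReal.top_div_of_ne_top ENNReal.ofReal_ne_top,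
        ENNReal.top_mul]
      exact (ENNReal.rpow_pos (ENNReal.ofReal_pos.2 hx) ENNReal.ofReal_ne_top).ne'
    rw [ENNReal.tsum_eq_top_of_eq_top ⟨0, h0⟩, ENNReal.mul_top (by simp [hR0.ne'])]
    exact le_top
  have hfin (j : ℕ) : stoppedOsc P ℱ 1 f (x / 2 ^ j) / ENNReal.ofReal (x / 2 ^ j) ≠ ⊤ :=
    ENNReal.div_ne_top (ne_top_of_le_ne_top htop (stoppedOsc_mono 1 f
      (div_le_self hx.le (one_le_pow₀ one_le_two)))) (hxe j)
  let c : ℕ → ℝ≥0 := fun j =>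
    (stoppedOsc P ℱ 1 f (x / 2 ^ j) / ENNReal.ofReal (x / 2 ^ j)).toNNReal
  have hc (j : ℕ) : (c j : ℝ≥0∞) = stoppedOsc P ℱ 1 f (x / 2 ^ j) / ENNReal.ofReal (x / 2 ^ j) :=
    ENNReal.coe_toNNReal (hfin j)
  refine iSup_le fun ν => iSup_le fun hν => iSup_le fun hνx => ?_
  let S : ℕ → Type _ := fun j => {τ : Ω → WithTop ℕ //
    IsStoppingTime ℱ τ ∧ P {ω | τ ω < ⊤} ≤ ENNReal.ofReal (x / 2 ^ j)}
  have step (j : ℕ) (τ : S j) : ∃ σ : S (j + 1),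
      ∀ᵐ ω ∂P, ‖stoppedFun P ℱ f σ.1 ω - stoppedFun P ℱ f τ.1 ω‖ ≤
        {ω | τ.1 ω < ⊤}.indicator (fun _ => (2 * R * c j : ℝ)) ω := by
    have hy : eLpNorm (fun ω => f ω - stoppedFun P ℱ f τ.1 ω) 1 P ≤
        c j * ENNReal.ofReal (x / 2 ^ j) := by
      rw [hc, ENNReal.div_mul_cancel (hxe j) ENNReal.ofReal_ne_top, ← ENNReal.ofReal_one]
      exact eLpNorm_sub_stoppedFun_le_stoppedOsc τ.2.1 τ.2.2
    obtain ⟨σ, hσ, hPσ, hb⟩ := exists_next_isStoppingTime hgen hR hf τ.2.1 hy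
    refine ⟨⟨σ, hσ, hPσ.trans (le_of_eq ?_)⟩, hb⟩
    rw [pow_succ, ← div_div, ENNReal.ofReal_div_of_pos two_pos, ENNReal.ofReal_ofNat]
  choose next hnext using step
  let τ : ∀ j, S j := fun j => Nat.rec ⟨ν, hν, by simpa using hνx⟩ (fun j σ => next j σ) j
  have hτ (j : ℕ) := hnext j (τ j)
  have hsum : ∑' j, P {ω | (τ j).1 ω < ⊤} ≠ ∞ := by
    refine ne_top_of_le_ne_top ?_ (ENNReal.tsum_le_tsum fun j => (τ j).2.2)
    have hs : Summable fun j : ℕ => x / 2 ^ j := by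
      simpa [div_eq_mul_inv] using
        (summable_geometric_of_lt_one (r := (2 : ℝ)⁻¹) (by norm_num) (by norm_num)).mul_left x
    rw [← ENNReal.ofReal_tsum_of_nonneg (fun j => (hxj j).le) hs]
    exact ENNReal.ofReal_ne_top
  refine (eLpNorm_sub_stoppedFun_le_tsum hf.aestronglyMeasurable
    (ENNReal.one_le_ofReal.2 hq) (fun j => (τ j).2.1) hsum).trans ?_
  rw [← ENNReal.tsum_mul_left]
  refine ENNReal.tsum_le_tsum fun j => ?_
  refine (eLpNorm_mono_ae_real (hτ j)).trans ((eLpNorm_indicator_const_le _ _).trans ?_)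
  rw [ENNReal.toReal_ofReal (by linarith), ← hc, ← mul_assoc]
  refine mul_le_mul' (le_of_eq ?_) (ENNReal.rpow_le_rpow (τ j).2.2 (by positivity))
  have : (2 * R * c j : ℝ) = ((2 * R * c j : ℝ≥0) : ℝ) := by push_cast; ring
  rw [this, Real.enorm_eq_ofReal (NNReal.coe_nonneg _), ENNReal.ofReal_coe_nnreal]
  simp

end Oscillation

/-! ### The inverse of the concave function `Φ` -/

section Orlicz

variable {ℓ : ℝ} {Φ : ℝ → ℝ}

theorem OrliczClass.strictMonoOn (hΦ : OrliczClass ℓ Φ) (hconc : ConcaveOn ℝ (Ici 0) Φ) :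
    StrictMonoOn Φ (Ici 0) := by
  intro a ha b hb hab
  by_contra! hle
  obtain ⟨r, hr, hbr⟩ :=
    ((hΦ.tendsto_atTop.eventually_gt_atTop (Φ b)).and (eventually_gt_atTop b)).exists
  have h := hconc.slope_anti_adjacent ha (mem_Ici.2 ((mem_Ici.1 hb).trans hbr.le)) hab hbr
  have h1 : (Φ b - Φ a) / (b - a) ≤ 0 :=
    div_nonpos_of_nonpos_of_nonneg (by linarith) (by linarith)
  have h2 : 0 < (Φ r - Φ b) / (r - b) := div_pos (by linarith) (by linarith)
  linarith

theorem OrliczClass.continuousOn (hℓ : 0 < ℓ) (hΦ : OrliczClass ℓ Φ)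
    (hconc : ConcaveOn ℝ (Ici 0) Φ) : ContinuousOn Φ (Ici 0) := by
  intro x hx
  rcases (mem_Ici.1 hx).eq_or_lt with rfl | hx0
  · obtain ⟨c, -, hc⟩ := hΦ.type_le
    have hmax : Tendsto (fun t : ℝ => c * max (t ^ ℓ) t * Φ 1) (𝓝[Ici 0] 0) (𝓝 0) := by
      have h1 : Continuous fun t : ℝ => c * max (t ^ ℓ) t * Φ 1 := by
        have := Real.continuous_rpow_const hℓ.le
        fun_prop
      have h2 := h1.continuousWithinAt (s := Ici 0) (x := 0)
      simpa [ContinuousWithinAt, Real.zero_rpow hℓ.ne'] using h2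
    rw [ContinuousWithinAt, hΦ.map_zero]
    refine tendsto_of_tendsto_of_tendsto_of_le_of_le' tendsto_const_nhds hmax ?_ ?_
    · filter_upwards [self_mem_nhdsWithin] with t ht using hΦ.nonneg t ht
    · filter_upwards [self_mem_nhdsWithin] with t ht
      simpa using hc t 1 ht zero_le_one
  · have h := (hconc.subset Ioi_subset_Ici_self (convex_Ioi 0)).continuousOn isOpen_Ioi
    exact (h.continuousAt (Ioi_mem_nhds hx0)).continuousWithinAt

theorem OrliczClass.surjOn (hℓ : 0 < ℓ) (hΦ : OrliczClass ℓ Φ)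
    (hconc : ConcaveOn ℝ (Ici 0) Φ) : SurjOn Φ (Ici 0) (Ici 0) := by
  intro y hy
  obtain ⟨M, hM, hM0⟩ :=
    ((hΦ.tendsto_atTop.eventually_ge_atTop y).and (eventually_ge_atTop 0)).exists
  obtain ⟨r, hr, hry⟩ := intermediate_value_Icc hM0
    ((hΦ.continuousOn hℓ hconc).mono Icc_subset_Ici_self) ⟨by rw [hΦ.map_zero]; exact hy, hM⟩
  exact ⟨r, hr.1, hry⟩

theorem orliczInv_nonneg (hsurj : SurjOn Φ (Ici 0) (Ici 0)) {s : ℝ} (hs : 0 ≤ s) :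
    0 ≤ orliczInv Φ s := Function.invFunOn_mem (hsurj hs)

theorem apply_orliczInv (hsurj : SurjOn Φ (Ici 0) (Ici 0)) {s : ℝ} (hs : 0 ≤ s) :
    Φ (orliczInv Φ s) = s := Function.invFunOn_eq (hsurj hs)

theorem orliczInv_pos (h0 : Φ 0 = 0) (hsurj : SurjOn Φ (Ici 0) (Ici 0)) {s : ℝ} (hs : 0 < s) :
    0 < orliczInv Φ s := by
  refine (orliczInv_nonneg hsurj hs.le).lt_of_ne fun h => hs.ne ?_
  rw [← apply_orliczInv hsurj hs.le, ← h, h0]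

theorem monotoneOn_orliczInv (hmono : StrictMonoOn Φ (Ici 0)) (hsurj : SurjOn Φ (Ici 0) (Ici 0)) :
    MonotoneOn (orliczInv Φ) (Ici 0) := by
  intro a ha b hb hab
  rw [← hmono.le_iff_le (orliczInv_nonneg hsurj ha) (orliczInv_nonneg hsurj hb),
    apply_orliczInv hsurj ha, apply_orliczInv hsurj hb]
  exact hab

/-- The convexity of `Φ⁻¹`, in the form in which it is used. -/
theorem orliczInv_div_le (h0 : Φ 0 = 0) (hconc : ConcaveOn ℝ (Ici 0) Φ)
    (hmono : StrictMonoOn Φ (Ici 0)) (hsurj : SurjOn Φ (Ici 0) (Ici 0)) {s K : ℝ} (hs : 0 ≤ s)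
    (hK : 1 ≤ K) : orliczInv Φ (s / K) ≤ orliczInv Φ s / K := by
  have hK0 : 0 < K := by linarith
  have hr := orliczInv_nonneg hsurj hs
  have hsK : 0 ≤ s / K := by positivity
  rw [← hmono.le_iff_le (orliczInv_nonneg hsurj hsK) (mem_Ici.2 (by positivity)),
    apply_orliczInv hsurj hsK]
  have h := hconc.2 (mem_Ici.2 hr) (mem_Ici.2 le_rfl) (inv_nonneg.2 hK0.le)
    (sub_nonneg.2 (inv_le_one_of_one_le₀ hK)) (by ring)
  rw [apply_orliczInv hsurj hs, h0] at h
  simpa [div_eq_inv_mul] using h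

end Orlicz

/-! ### The weak Campanato norms -/

section Campanato

theorem lintegral_Ioi_comp_div (F : ℝ → ℝ≥0∞) {m : ℝ} (hm : 0 < m) :
    ENNReal.ofReal m⁻¹ * ∫⁻ x in Ioi (0 : ℝ), F (x / m) = ∫⁻ x in Ioi (0 : ℝ), F x := by
  have hm' : m⁻¹ ≠ 0 := (inv_pos.2 hm).ne'
  have h1 : ∫⁻ x in Ioi (0 : ℝ), F (x / m) = ∫⁻ x, (Ioi (0 : ℝ)).indicator F (m⁻¹ * x) := by
    rw [← lintegral_indicator measurableSet_Ioi]
    refine lintegral_congr fun x => ?_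
    have : 0 < m⁻¹ * x ↔ 0 < x := by rw [← div_eq_inv_mul, div_pos_iff_of_pos_right hm]
    simp only [indicator_apply, mem_Ioi, this, div_eq_inv_mul]
  have h2 := (Homeomorph.mulLeft₀ m⁻¹ hm').measurableEmbedding.lintegral_map
    (μ := volume) ((Ioi (0 : ℝ)).indicator F)
  rw [Homeomorph.coe_mulLeft₀, Real.map_volume_mul_left hm', lintegral_smul_measure, inv_inv,
    abs_of_pos hm, lintegral_indicator measurableSet_Ioi] at h2
  rw [h1, ← h2, smul_eq_mul, ← mul_assoc, ← ENNReal.ofReal_mul (inv_pos.2 hm).le,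
    inv_mul_cancel₀ hm.ne', ENNReal.ofReal_one, one_mul]

variable {Ω : Type*} {mΩ : MeasurableSpace Ω} {P : Measure Ω} {ℱ : Filtration ℕ mΩ}
  {φ Ψ : ℝ → ℝ}

theorem tPhi_div_eq (hφ : ∀ r : ℝ, 0 < r → φ r = 1 / (r * Ψ (1 / r)))
    (q : ℝ) (f : Ω → ℝ) {x : ℝ} (hx : 0 < x) :
    tPhi P ℱ q φ f x / ENNReal.ofReal x =
      ENNReal.ofReal (Ψ (1 / x)) * (ENNReal.ofReal x ^ (1 / q))⁻¹ * stoppedOsc P ℱ q f x := by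
  have hx' : ENNReal.ofReal x ≠ 0 := (ENNReal.ofReal_pos.2 hx).ne'
  have h1 : 1 / φ x * x ^ (-1 / q) = x * (x ^ (-1 / q) * Ψ (1 / x)) := by
    rw [hφ x hx, one_div_one_div]
    ring
  have h2 : (ENNReal.ofReal x ^ (1 / q))⁻¹ = ENNReal.ofReal (x ^ (-1 / q)) := by
    rw [← ENNReal.rpow_neg, ENNReal.ofReal_rpow_of_pos hx, neg_div]
  rw [tPhi, h1, ENNReal.ofReal_mul hx.le, ENNReal.ofReal_mul (Real.rpow_nonneg hx.le _), h2,
    mul_assoc, ENNReal.mul_div_right_comm, ENNReal.div_self hx' ENNReal.ofReal_ne_top, one_mul,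
    mul_comm (ENNReal.ofReal (x ^ _))]

theorem wCampanatoNorm_eq (hφ : ∀ r : ℝ, 0 < r → φ r = 1 / (r * Ψ (1 / r)))
    (q : ℝ) (f : Ω → ℝ) :
    wCampanatoNorm P ℱ q φ f = ∫⁻ x in Ioi (0 : ℝ),
      ENNReal.ofReal (Ψ (1 / x)) * (ENNReal.ofReal x ^ (1 / q))⁻¹ * stoppedOsc P ℱ q f x :=
  setLIntegral_congr_fun measurableSet_Ioi fun _ hx => tPhi_div_eq hφ q f hx

theorem wCampanatoNorm_one_le (hφ : ∀ r : ℝ, 0 < r → φ r = 1 / (r * Ψ (1 / r)))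
    {q : ℝ} (hq : 1 ≤ q) {f : Ω → ℝ} (hf : AEStronglyMeasurable f P) :
    wCampanatoNorm P ℱ 1 φ f ≤ wCampanatoNorm P ℱ q φ f := by
  rw [wCampanatoNorm_eq hφ, wCampanatoNorm_eq hφ]
  refine setLIntegral_mono' measurableSet_Ioi fun x hx => ?_
  have hx' : ENNReal.ofReal x ≠ 0 := (ENNReal.ofReal_pos.2 hx).ne'
  rw [mul_assoc, mul_assoc]
  refine mul_le_mul' le_rfl ?_
  calc (ENNReal.ofReal x ^ (1 / 1 : ℝ))⁻¹ * stoppedOsc P ℱ 1 f x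
      ≤ (ENNReal.ofReal x ^ (1 / 1 : ℝ))⁻¹ *
        (stoppedOsc P ℱ q f x * ENNReal.ofReal x ^ (1 - 1 / q)) :=
        mul_le_mul' le_rfl (stoppedOsc_one_le hq hf)
    _ = ENNReal.ofReal x ^ (-(1 / 1 : ℝ)) * ENNReal.ofReal x ^ (1 - 1 / q) *
        stoppedOsc P ℱ q f x := by
        rw [ENNReal.rpow_neg]
        ring
    _ = (ENNReal.ofReal x ^ (1 / q))⁻¹ * stoppedOsc P ℱ q f x := by
        rw [← ENNReal.rpow_add _ _ hx' ENNReal.ofReal_ne_top, ← ENNReal.rpow_neg]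
        congr 2
        ring

/-- The John–Nirenberg inequality for the norms: the bound of `stoppedOsc` by its values at the
scales `x / 2 ^ j` is integrated, the factor `2 ^ j` produced by the dilation being absorbed by
the convexity of `Ψ`. -/
theorem exists_wCampanatoNorm_le [IsFiniteMeasure P]
    (hgen : ⨆ n, (ℱ n : MeasurableSpace Ω) = mΩ) (hreg : IsRegularBasis P ℱ)
    (hφ : ∀ r : ℝ, 0 < r → φ r = 1 / (r * Ψ (1 / r)))
    (hmono : MonotoneOn Ψ (Ici 0))
    (hdiv : ∀ s K : ℝ, 0 ≤ s → 1 ≤ K → Ψ (s / K) ≤ Ψ s / K) {q : ℝ} (hq : 1 ≤ q) :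
    ∃ C : ℝ, 0 < C ∧ ∀ f : Ω → ℝ, Integrable f P →
      wCampanatoNorm P ℱ q φ f ≤ ENNReal.ofReal C * wCampanatoNorm P ℱ 1 φ f := by
  obtain ⟨R, hR0, hR⟩ := hreg
  have hq0 : 0 < 1 / q := by positivity
  let a : ℝ≥0∞ := ENNReal.ofReal 2⁻¹ ^ (1 / q)
  have ha : a < 1 := ENNReal.rpow_lt_one (by norm_num) hq0
  have hK : 2 * R * (1 - a)⁻¹ ≠ ⊤ :=
    ENNReal.mul_ne_top (by finiteness) (ENNReal.inv_ne_top.2 (tsub_pos_of_lt ha).ne')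
  have hK0 : 2 * R * (1 - a)⁻¹ ≠ 0 := by
    refine mul_ne_zero (by simp [hR0.ne']) (ENNReal.inv_ne_zero.2 ?_)
    exact ne_top_of_le_ne_top ENNReal.one_ne_top tsub_le_self
  refine ⟨(2 * R * (1 - a)⁻¹).toReal, ENNReal.toReal_pos hK0 hK, fun f hf => ?_⟩
  rw [ENNReal.ofReal_toReal hK]
  let F : ℝ → ℝ≥0∞ := fun x =>
    ENNReal.ofReal (Ψ (1 / x)) * (ENNReal.ofReal x ^ (1 / 1 : ℝ))⁻¹ * stoppedOsc P ℱ 1 f x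
  have hFm (m : ℝ) (hm : 0 < m) :
      AEMeasurable (fun x => F (x / m)) (volume.restrict (Ioi 0)) := by
    have h1 : AEMeasurable (fun x => Ψ (1 / (x / m))) (volume.restrict (Ioi 0)) := by
      refine aemeasurable_restrict_of_antitoneOn measurableSet_Ioi fun x hx y hy hxy => ?_
      have hx' : 0 < x := hx
      have hy' : 0 < y := hy
      refine hmono (mem_Ici.2 (by positivity)) (mem_Ici.2 (by positivity)) ?_
      gcongr
    have h2 : Measurable fun x : ℝ => (ENNReal.ofReal (x / m) ^ (1 / 1 : ℝ))⁻¹ := by fun_prop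
    have h3 : Measurable fun x => stoppedOsc P ℱ 1 f (x / m) :=
      (stoppedOsc_mono 1 f).measurable.comp (by fun_prop)
    exact (h1.ennreal_ofReal.mul h2.aemeasurable).mul h3.aemeasurable
  have hpt (x : ℝ) (hx : 0 < x) :
      ENNReal.ofReal (Ψ (1 / x)) * (ENNReal.ofReal x ^ (1 / q))⁻¹ * stoppedOsc P ℱ q f x ≤
      2 * R * ∑' j : ℕ, a ^ j * (ENNReal.ofReal (2 ^ j)⁻¹ * F (x / 2 ^ j)) := by
    refine (mul_le_mul' le_rfl (stoppedOsc_le_tsum hgen hR0 hR hf hq hx)).trans ?_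
    rw [mul_left_comm, ← ENNReal.tsum_mul_left]
    refine mul_le_mul' le_rfl (ENNReal.tsum_le_tsum fun j => ?_)
    have hj : (0 : ℝ) < 2 ^ j := by positivity
    have hΨ : ENNReal.ofReal (Ψ (1 / x)) ≤
        ENNReal.ofReal (2 ^ j)⁻¹ * ENNReal.ofReal (Ψ (1 / (x / 2 ^ j))) := by
      rw [← ENNReal.ofReal_mul (inv_nonneg.2 hj.le)]
      refine ENNReal.ofReal_le_ofReal ?_
      have h := hdiv (1 / (x / 2 ^ j)) (2 ^ j) (by positivity) (one_le_pow₀ one_le_two)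
      rw [← div_eq_inv_mul]
      convert h using 2
      field_simp
    have hpow : (ENNReal.ofReal x ^ (1 / q))⁻¹ * ENNReal.ofReal (x / 2 ^ j) ^ (1 / q) = a ^ j := by
      have hx1 : ENNReal.ofReal x ^ (1 / q) ≠ 0 :=
        (ENNReal.rpow_pos (ENNReal.ofReal_pos.2 hx) ENNReal.ofReal_ne_top).ne'
      have hx2 : ENNReal.ofReal x ^ (1 / q) ≠ ⊤ :=
        ENNReal.rpow_ne_top_of_nonneg hq0.le ENNReal.ofReal_ne_top
      rw [div_eq_mul_inv x, ENNReal.ofReal_mul hx.le, ENNReal.mul_rpow_of_nonneg _ _ hq0.le,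
        ← mul_assoc, ENNReal.inv_mul_cancel hx1 hx2, one_mul, ← inv_pow,
        ENNReal.ofReal_pow (by norm_num), ← ENNReal.rpow_natCast, ← ENNReal.rpow_mul,
        mul_comm, ENNReal.rpow_mul, ENNReal.rpow_natCast]
    calc ENNReal.ofReal (Ψ (1 / x)) * (ENNReal.ofReal x ^ (1 / q))⁻¹ *
          (stoppedOsc P ℱ 1 f (x / 2 ^ j) / ENNReal.ofReal (x / 2 ^ j) *
            ENNReal.ofReal (x / 2 ^ j) ^ (1 / q))
        = ((ENNReal.ofReal x ^ (1 / q))⁻¹ * ENNReal.ofReal (x / 2 ^ j) ^ (1 / q)) *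
          (ENNReal.ofReal (Ψ (1 / x)) *
            ((ENNReal.ofReal (x / 2 ^ j))⁻¹ * stoppedOsc P ℱ 1 f (x / 2 ^ j))) := by
          rw [div_eq_mul_inv (stoppedOsc P ℱ 1 f (x / 2 ^ j))]
          ring
      _ ≤ a ^ j * ((ENNReal.ofReal (2 ^ j)⁻¹ * ENNReal.ofReal (Ψ (1 / (x / 2 ^ j)))) *
            ((ENNReal.ofReal (x / 2 ^ j))⁻¹ * stoppedOsc P ℱ 1 f (x / 2 ^ j))) := by
          rw [hpow]
          gcongr
      _ = a ^ j * (ENNReal.ofReal (2 ^ j)⁻¹ * F (x / 2 ^ j)) := by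
          simp only [F, div_one, ENNReal.rpow_one]
          ring
  rw [wCampanatoNorm_eq hφ, wCampanatoNorm_eq hφ]
  calc ∫⁻ x in Ioi (0 : ℝ),
        ENNReal.ofReal (Ψ (1 / x)) * (ENNReal.ofReal x ^ (1 / q))⁻¹ * stoppedOsc P ℱ q f x
      ≤ ∫⁻ x in Ioi (0 : ℝ),
          2 * R * ∑' j : ℕ, a ^ j * (ENNReal.ofReal (2 ^ j)⁻¹ * F (x / 2 ^ j)) :=
        setLIntegral_mono' measurableSet_Ioi fun x hx => hpt x hx
    _ = 2 * R * ∑' j : ℕ, ∫⁻ x in Ioi (0 : ℝ),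
          a ^ j * (ENNReal.ofReal (2 ^ j)⁻¹ * F (x / 2 ^ j)) := by
        rw [lintegral_const_mul' _ _ (by finiteness), lintegral_tsum]
        exact fun j => ((hFm _ (by positivity)).const_mul _).const_mul _
    _ = 2 * R * ∑' j : ℕ, a ^ j * ∫⁻ x in Ioi (0 : ℝ), F x := by
        congr 2
        funext j
        rw [lintegral_const_mul' _ _ (ENNReal.pow_ne_top ha.ne_top),
          lintegral_const_mul' _ _ ENNReal.ofReal_ne_top, lintegral_Ioi_comp_div F (by positivity)]
    _ = 2 * R * (1 - a)⁻¹ * ∫⁻ x in Ioi (0 : ℝ), F x := by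
        rw [ENNReal.tsum_mul_right, ENNReal.tsum_geometric, ← mul_assoc]

/-- A finite norm forces a finite supremum over all stopping times: `stoppedOsc` is constant on
`[1, ∞)` and its weight is positive there. -/
theorem stoppedOsc_one_ne_top (hφ : ∀ r : ℝ, 0 < r → φ r = 1 / (r * Ψ (1 / r)))
    (hpos : ∀ s : ℝ, 0 < s → 0 < Ψ s) {q : ℝ} (hq : 1 ≤ q) {f : Ω → ℝ}
    (h : wCampanatoNorm P ℱ q φ f < ∞) : stoppedOsc P ℱ q f 1 ≠ ∞ := by
  intro htop
  rw [wCampanatoNorm_eq hφ] at h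
  refine h.ne (top_le_iff.1 ?_)
  calc (⊤ : ℝ≥0∞) = ∫⁻ _ in Ioi (1 : ℝ), (⊤ : ℝ≥0∞) := by simp
    _ ≤ ∫⁻ x in Ioi (1 : ℝ), ENNReal.ofReal (Ψ (1 / x)) * (ENNReal.ofReal x ^ (1 / q))⁻¹ *
          stoppedOsc P ℱ q f x := by
        refine setLIntegral_mono' measurableSet_Ioi fun x hx => ?_
        have hx1 : 1 < x := hx
        have h1 : stoppedOsc P ℱ q f x = ⊤ := top_le_iff.1 (htop ▸ stoppedOsc_mono q f hx1.le)
        have h2 : ENNReal.ofReal (Ψ (1 / x)) ≠ 0 :=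
          (ENNReal.ofReal_pos.2 (hpos _ (by positivity))).ne'
        have h3 : (ENNReal.ofReal x ^ (1 / q))⁻¹ ≠ 0 :=
          ENNReal.inv_ne_zero.2
            (ENNReal.rpow_ne_top_of_nonneg (by positivity) ENNReal.ofReal_ne_top)
        rw [h1, ENNReal.mul_top (mul_ne_zero h2 h3)]
    _ ≤ _ := lintegral_mono_set (Ioi_subset_Ioi zero_le_one)

theorem memLp_of_wCampanatoNorm_lt_top [IsProbabilityMeasure P]
    (hφ : ∀ r : ℝ, 0 < r → φ r = 1 / (r * Ψ (1 / r)))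
    (hpos : ∀ s : ℝ, 0 < s → 0 < Ψ s) {q : ℝ} (hq : 1 ≤ q) {f : Ω → ℝ}
    (hf : AEStronglyMeasurable f P) (h : wCampanatoNorm P ℱ q φ f < ∞)
    (h0 : MemLp (P[f | ℱ 0]) (ENNReal.ofReal q) P) : MemLp f (ENNReal.ofReal q) P := by
  have hν : IsStoppingTime ℱ fun _ : Ω => ((0 : ℕ) : WithTop ℕ) := isStoppingTime_const ℱ 0
  have h1 : MemLp (fun ω => f ω - stoppedFun P ℱ f (fun _ => ((0 : ℕ) : WithTop ℕ)) ω)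
      (ENNReal.ofReal q) P :=
    ⟨hf.sub (aestronglyMeasurable_stoppedFun hf hν),
      (eLpNorm_sub_stoppedFun_le_stoppedOsc hν (by simp)).trans_lt
        (stoppedOsc_one_ne_top hφ hpos hq h).lt_top⟩
  refine (h1.add h0).ae_eq (Eventually.of_forall fun ω => ?_)
  rw [Pi.add_apply, stoppedFun_of_eq_coe (ν := fun _ => ((0 : ℕ) : WithTop ℕ)) rfl,
    sub_add_cancel]

/-- Under regularity at time `0` an integrable `ℱ 0`-measurable function is essentially bounded:
it can exceed a large multiple of its mean only on a set too small not to be null. -/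
theorem memLp_top_of_isRegularAtZero [IsProbabilityMeasure P] (hreg : IsRegularAtZero P ℱ)
    {g : Ω → ℝ} (hg : StronglyMeasurable[ℱ 0] g) (hgi : Integrable g P) : MemLp g ∞ P := by
  obtain ⟨R, hR0, hR⟩ := hreg
  -- The summand `1` makes Markov's inequality strict, also when the mean is `0`.
  let M : ℝ := R * (∫ ω, |g ω| ∂P) + 1
  have hI : 0 ≤ ∫ ω, |g ω| ∂P := integral_nonneg fun _ => abs_nonneg _
  let A : Set Ω := {ω | M ≤ |g ω|}
  have hA : MeasurableSet[ℱ 0] A := measurableSet_le measurable_const hg.norm.measurable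
  have hmarkov : M * P.real A ≤ ∫ ω, |g ω| ∂P :=
    mul_meas_ge_le_integral_of_nonneg (Eventually.of_forall fun _ => abs_nonneg _) hgi.abs M
  have hA0 : P A = 0 := by
    by_contra hne
    have h1 : (1 : ℝ) ≤ R * P.real A := by
      have := ENNReal.toReal_mono (by finiteness) (hR A hA hne)
      simpa [Measure.real] using this
    have h2 : R * (M * P.real A) ≤ R * ∫ ω, |g ω| ∂P :=
      mul_le_mul_of_nonneg_left hmarkov R.2
    have hM : 0 < M := by positivity
    have h3 : M * 1 ≤ M * (R * P.real A) := mul_le_mul_of_nonneg_left h1 hM.le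
    have h4 : M = R * (∫ ω, |g ω| ∂P) + 1 := rfl
    linarith
  refine memLp_top_of_bound hgi.aestronglyMeasurable M ?_
  filter_upwards [compl_mem_ae_iff.2 hA0] with ω hω
  exact (not_le.1 (show ¬ M ≤ |g ω| from hω)).le

end Campanato

/-! ### Coincidence of the spaces -/

theorem theorem5p4 {Ω : Type*} {mΩ : MeasurableSpace Ω} (P : Measure Ω) [IsProbabilityMeasure P]
    (ℱ : Filtration ℕ mΩ) (hgen : ⨆ n, (ℱ n : MeasurableSpace Ω) = mΩ)
    (hreg : IsRegularBasis P ℱ)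
    (ℓ : ℝ) (hℓ : ℓ ∈ Set.Ioc (0 : ℝ) 1) (Φ : ℝ → ℝ) (hΦ : OrliczClass ℓ Φ)
    (hconc : ConcaveOn ℝ (Set.Ici 0) Φ) (hindex : upperIndex (orliczInv Φ) < ∞)
    (φ : ℝ → ℝ) (hφ : ∀ r : ℝ, 0 < r → φ r = 1 / (r * orliczInv Φ (1 / r)))
    (q₁ q₂ : ℝ) (hq₁ : 1 ≤ q₁) (hq₂ : 1 ≤ q₂) :
    wCampanatoZero P ℱ q₁ φ = wCampanatoZero P ℱ q₂ φ ∧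
    (IsRegularAtZero P ℱ → wCampanato P ℱ q₁ φ = wCampanato P ℱ q₂ φ) ∧
    ∃ C : ℝ, 0 < C ∧ ∀ f : Ω → ℝ, Integrable f P →
      wCampanatoNorm P ℱ q₁ φ f ≤ ENNReal.ofReal C * wCampanatoNorm P ℱ q₂ φ f ∧
      wCampanatoNorm P ℱ q₂ φ f ≤ ENNReal.ofReal C * wCampanatoNorm P ℱ q₁ φ f := by
  have hmono := hΦ.strictMonoOn hconc
  have hsurj := hΦ.surjOn hℓ.1 hconc
  have hpos : ∀ s : ℝ, 0 < s → 0 < orliczInv Φ s := fun s => orliczInv_pos hΦ.map_zero hsurj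
  have key {p : ℝ} (hp : 1 ≤ p) {q : ℝ} (hq : 1 ≤ q) : ∃ C : ℝ, 0 < C ∧ ∀ f : Ω → ℝ,
      Integrable f P → wCampanatoNorm P ℱ q φ f ≤ ENNReal.ofReal C * wCampanatoNorm P ℱ p φ f := by
    obtain ⟨C, hC, h⟩ := exists_wCampanatoNorm_le hgen hreg hφ (monotoneOn_orliczInv hmono hsurj)
      (fun s K => orliczInv_div_le hΦ.map_zero hconc hmono hsurj) hq
    exact ⟨C, hC, fun f hf => (h f hf).trans
      (mul_le_mul' le_rfl (wCampanatoNorm_one_le hφ hp hf.aestronglyMeasurable))⟩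
  have incl {p q : ℝ} (hp : 1 ≤ p) (hq : 1 ≤ q) {f : Ω → ℝ} (hf : f ∈ wCampanato P ℱ p φ)
      (h0 : MemLp (P[f | ℱ 0]) (ENNReal.ofReal q) P) : f ∈ wCampanato P ℱ q φ := by
    obtain ⟨C, -, hC⟩ := key hp hq
    have hfi : Integrable f P := hf.1.integrable (ENNReal.one_le_ofReal.2 hp)
    have hn := (hC f hfi).trans_lt (ENNReal.mul_lt_top ENNReal.ofReal_lt_top hf.2)
    exact ⟨memLp_of_wCampanatoNorm_lt_top hφ hpos hq hfi.aestronglyMeasurable hn h0, hn⟩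
  have inclZero {p q : ℝ} (hp : 1 ≤ p) (hq : 1 ≤ q) :
      wCampanatoZero P ℱ p φ ⊆ wCampanatoZero P ℱ q φ := fun f hf =>
    ⟨incl hp hq hf.1 (MemLp.zero.ae_eq hf.2.symm), hf.2⟩
  have inclReg (h : IsRegularAtZero P ℱ) {p q : ℝ} (hp : 1 ≤ p) (hq : 1 ≤ q) :
      wCampanato P ℱ p φ ⊆ wCampanato P ℱ q φ := fun f hf =>
    incl hp hq hf ((memLp_top_of_isRegularAtZero h stronglyMeasurable_condExp
      integrable_condExp).mono_exponent le_top)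
  refine ⟨(inclZero hq₁ hq₂).antisymm (inclZero hq₂ hq₁),
    fun h => (inclReg h hq₁ hq₂).antisymm (inclReg h hq₂ hq₁), ?_⟩
  obtain ⟨C₁, hC₁, h₁⟩ := key hq₂ hq₁
  obtain ⟨C₂, hC₂, h₂⟩ := key hq₁ hq₂
  refine ⟨max C₁ C₂, lt_max_of_lt_left hC₁, fun f hf => ⟨(h₁ f hf).trans ?_, (h₂ f hf).trans ?_⟩⟩
  · gcongr
    exact le_max_left _ _
  · gcongr
    exact le_max_right _ _
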